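/- Let $m>0$, $B\in\mathbb R$ and $\gamma>0$. For $T>0$ put $\widetilde T=T/m$, $\mu=\mu(T)=m\,(1+B\,\widetilde T^{1+\gamma})$ and $$f_{FD}(p)=\frac{1}{e^{(\sqrt{p^2+m^2}-\mu)/T}+1},\qquad p\ge 0 .$$ Let $G:[0,\infty)\to\mathbb R$ be $C^2$ (one-sidedly at $0$) and suppose that $G,G',G''$ are polynomially bounded on $[0,\infty)$. For real $D\ge 2$ and $n\in\{0,1\}$ let $$a_n=a_n(m)=\frac1{n!}\,\partial_y^n\Big|_{y=0^+}\Big[(y^2+1)(y^2+2)^{(D-2)/2}\,G\big(my\sqrt{y^2+2}\big)\Big],$$ so that $a_0=2^{(D-2)/2}G(0)$ and $a_1=2^{(D-1)/2}mG'(0)$. Then the integrals below converge absolutely for every $T>0$, and, as $\widetilde T\to0^+$ with $m,B,\gamma,G,D$ fixed: (1) For every real $D>2$, $$\begin{aligned}\int_0^\infty p^{D-1}G(p)f_{FD}(p)\,dp ={}&a_0m^D\big(1-2^{-(D-2)/2}\big)\Gamma(\tfrac D2)\,\zeta(\tfrac D2)\,\widetilde T^{D/2} +a_0m^DB\,\tfrac{D-2}{2}\,c_D\,\widetilde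 T^{D/2+\gamma}\\ &+a_1m^D\big(1-2^{-(D-1)/2}\big)\Gamma(\tfrac{D+1}2)\,\zeta(\tfrac{D+1}2)\,\widetilde T^{(D+1)/2} +O\big(\widetilde T^{(D+2)/2}\big)+O\big(\widetilde T^{D/2+2\gamma}\big),\end{aligned}$$ where $c_D=(1-2^{2-D/2})\,\Gamma(\tfrac{D-2}2)\,\zeta(\tfrac{D-2}2)$ if $D\ne4$ and $c_4=\ln 2$. (2) For $D=2$, $$\int_0^\infty p\,G(p)f_{FD}(p)\,dp =a_0m^2\ln(2)\,\widetilde T+\tfrac12a_0m^2B\,\widetilde T^{1+\gamma} +a_1m^2\big(1-2^{-1/2}\big)\tfrac{\sqrt\pi}{2}\,\zeta(\tfrac32)\,\widetilde T^{3/2} +O\big(\widetilde T^{1+2\gamma}\big)+O\big(\widetilde T^{2}\big).$$ -/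

import Mathlib

open Filter Topology Asymptotics

noncomputable section

/-- The Fermi-Dirac occupation `1 / (exp ((E - μ) / T) + 1)` at momentum `p`, where
`E = √(p² + m²)` is the energy of a particle of mass `m`. -/
def fermiDirac (m μ T p : ℝ) : ℝ :=
  1 / (Real.exp ((√(p ^ 2 + m ^ 2) - μ) / T) + 1)

/-- The radial integrand `p ^ (D - 1) * G p * f_FD p` of the thermal average of `G`. -/
def fermiDiracIntegrand (D : ℝ) (G : ℝ → ℝ) (m μ T p : ℝ) : ℝ :=
  p ^ (D - 1) * G p * fermiDirac m μ T p

/-- The integral of `p ^ (D - 1) * G p * f_FD p` over `0 < p < ∞`. -/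
def fermiDiracIntegral (D : ℝ) (G : ℝ → ℝ) (m μ T : ℝ) : ℝ :=
  ∫ p in Set.Ioi (0 : ℝ), fermiDiracIntegrand D G m μ T p

/-- The chemical potential `μ = m (1 + B T̃ ^ (1 + γ))`, where `T̃ = T / m`. -/
def chemicalPotential (m B γ T : ℝ) : ℝ :=
  m * (1 + B * (T / m) ^ (1 + γ))

/-- A function on `[0, ∞)` is polynomially bounded. -/
def PolynomiallyBounded (g : ℝ → ℝ) : Prop :=
  ∃ (C : ℝ) (N : ℕ), ∀ p : ℝ, 0 ≤ p → |g p| ≤ C * (1 + p ^ N)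

/-- `F(y, m) = (y² + 1) (y² + 2) ^ ((D - 2) / 2) G (m y √(y² + 2))`. -/
def expansionFunction (D : ℝ) (G : ℝ → ℝ) (m y : ℝ) : ℝ :=
  (y ^ 2 + 1) * (y ^ 2 + 2) ^ ((D - 2) / 2) * G (m * y * √(y ^ 2 + 2))

/-- The coefficient `a_n(m)`: `1 / n!` times the `n`-th derivative of `y ↦ F(y, m)` at `y = 0`.
As `G` is a function on `[0, ∞)`, the derivative at `0` is taken within `[0, ∞)`. -/
def expansionCoeff (D : ℝ) (G : ℝ → ℝ) (m : ℝ) (n : ℕ) : ℝ :=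
  1 / (n.factorial : ℝ) * iteratedDerivWithin n (expansionFunction D G m) (Set.Ici 0) 0

/-- The Riemann zeta function at a real argument, as a real number. -/
def realZeta (s : ℝ) : ℝ := (riemannZeta (s : ℂ)).re

theorem ofReal_realZeta (s : ℝ) : ((realZeta s : ℝ) : ℂ) = riemannZeta (s : ℂ) := by
  have h := riemannZeta_conj (s : ℂ)
  rw [Complex.conj_ofReal] at h
  exact Complex.conj_eq_iff_re.mp h.symm

end

/-! Put `t = T / m` and substitute the reduced kinetic energy `x`, with `√(p² + m²) = m (1 + t x)`.
The Fermi factor becomes `1 / (exp (x - η) + 1)` with `η = (μ - m) / T = B t ^ γ`, and the integral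
is exactly `m ^ D t ^ (D/2)` times the integral of `x ^ (D/2 - 1) F(√(t x)) / (exp (x - η) + 1)`,
where `F` is `expansionFunction` (`fermiDiracIntegral_eq`).

Two Taylor expansions remain. The first, `F(y) = a₀ + a₁ y` with remainder `O(y² + y ^ (2l+2))` on
all of `[0, ∞)`, produces the Fermi-Dirac functions `J_s(η)` at `s = D/2` and `s = (D+1)/2`. The
second is `J_s(η) = J_s(0) + η J_s'(0) + O(η²)`. The total relative error is `O(t + η²)`, which
gives the two remainders (`integral_fermiWeight_expansion`).

The coefficients are `J_s(0) = (1 - 2 ^ (1-s)) Γ(s) ζ(s)` for `s ≠ 1`, `J_1(0) = log 2`, `J_s'(0) =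
(s-1) J_{s-1}(0)` for `s > 1` and `J_1'(0) = 1/2`. The exceptional values at `s = 1` account for the
special cases `D = 4` and `D = 2`. -/

noncomputable section

/-! ### Fermi-Dirac functions and their expansion in `η` -/

/-- The Fermi-Dirac weight `1 / (exp (x - η) + 1)` in the reduced energy `x`. -/
def fermiWeight (η x : ℝ) : ℝ := 1 / (Real.exp (x - η) + 1)

/-- The (unnormalised) Fermi-Dirac function `∫ x ^ (s - 1) / (exp (x - η) + 1)`. -/
def fermiJ (s η : ℝ) : ℝ := ∫ x in Set.Ioi (0 : ℝ), x ^ (s - 1) * fermiWeight η x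

/-- The `η`-derivative of the Fermi-Dirac weight at `η = 0`. -/
def fermiWeightDeriv (x : ℝ) : ℝ := Real.exp x / (Real.exp x + 1) ^ 2

/-- The `η`-derivative of the Fermi-Dirac function at `η = 0`. -/
def fermiJDeriv (s : ℝ) : ℝ := ∫ x in Set.Ioi (0 : ℝ), x ^ (s - 1) * fermiWeightDeriv x

theorem continuous_fermiWeight (η : ℝ) : Continuous (fermiWeight η) := by
  unfold fermiWeight
  refine continuous_const.div (by fun_prop) fun x => by positivity

theorem continuous_fermiWeightDeriv : Continuous fermiWeightDeriv := by
  unfold fermiWeightDeriv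
  refine Continuous.div (by fun_prop) (by fun_prop) fun x => by positivity

theorem fermiWeight_nonneg (η x : ℝ) : 0 ≤ fermiWeight η x := by
  unfold fermiWeight; positivity

theorem fermiWeightDeriv_nonneg (x : ℝ) : 0 ≤ fermiWeightDeriv x := by
  unfold fermiWeightDeriv; positivity

theorem fermiWeight_le (η x : ℝ) : fermiWeight η x ≤ Real.exp η * Real.exp (-x) := by
  unfold fermiWeight
  rw [← Real.exp_add, div_le_iff₀ (by positivity), mul_add, ← Real.exp_add]
  have : η + -x + (x - η) = 0 := by ring
  rw [this, Real.exp_zero]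
  have := Real.exp_pos (η + -x)
  linarith

theorem fermiWeightDeriv_le (x : ℝ) : fermiWeightDeriv x ≤ Real.exp (-x) := by
  unfold fermiWeightDeriv
  rw [div_le_iff₀ (by positivity), Real.exp_neg]
  have := Real.exp_pos x
  field_simp
  nlinarith

/-- A continuous function of exponential decay is integrable against `x ^ (s - 1)`. -/
theorem integrableOn_rpow_mul_of_le_exp {s : ℝ} (hs : 0 < s) {f : ℝ → ℝ} {C : ℝ}
    (hf : ContinuousOn f (Set.Ioi 0)) (hb : ∀ x, 0 < x → |f x| ≤ C * Real.exp (-x)) :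
    MeasureTheory.IntegrableOn (fun x => x ^ (s - 1) * f x) (Set.Ioi 0) := by
  refine MeasureTheory.Integrable.mono' ((Real.GammaIntegral_convergent hs).const_mul C) ?_ ?_
  · refine ContinuousOn.aestronglyMeasurable (ContinuousOn.mul ?_ hf) measurableSet_Ioi
    exact fun x hx => (Real.continuousAt_rpow_const _ _ (Or.inl (ne_of_gt hx))).continuousWithinAt
  · filter_upwards [MeasureTheory.ae_restrict_mem measurableSet_Ioi] with x hx
    have hx : 0 < x := hx
    have h := Real.rpow_nonneg hx.le (s - 1)
    rw [Real.norm_eq_abs, abs_mul, abs_of_nonneg h]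
    calc _ ≤ x ^ (s - 1) * (C * Real.exp (-x)) := mul_le_mul_of_nonneg_left (hb x hx) h
      _ = _ := by ring

theorem abs_setIntegral_rpow_mul_le {s : ℝ} (hs : 0 < s) {f : ℝ → ℝ} {C : ℝ}
    (hb : ∀ x, 0 < x → |f x| ≤ C * Real.exp (-x)) :
    |∫ x in Set.Ioi (0 : ℝ), x ^ (s - 1) * f x| ≤ C * Real.Gamma s := by
  rw [Real.Gamma_eq_integral hs, ← MeasureTheory.integral_const_mul, ← Real.norm_eq_abs]
  refine MeasureTheory.norm_integral_le_of_norm_le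
    ((Real.GammaIntegral_convergent hs).const_mul C) ?_
  filter_upwards [MeasureTheory.ae_restrict_mem measurableSet_Ioi] with x hx
  have hx : 0 < x := hx
  have h := Real.rpow_nonneg hx.le (s - 1)
  rw [Real.norm_eq_abs, abs_mul, abs_of_nonneg h]
  calc _ ≤ x ^ (s - 1) * (C * Real.exp (-x)) := mul_le_mul_of_nonneg_left (hb x hx) h
    _ = _ := by ring

theorem integrableOn_rpow_mul_fermiWeight {s : ℝ} (hs : 0 < s) (η : ℝ) :
    MeasureTheory.IntegrableOn (fun x => x ^ (s - 1) * fermiWeight η x) (Set.Ioi 0) :=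
  integrableOn_rpow_mul_of_le_exp hs (continuous_fermiWeight η).continuousOn fun x _ => by
    rw [abs_of_nonneg (fermiWeight_nonneg η x)]; exact fermiWeight_le η x

theorem integrableOn_rpow_mul_fermiWeightDeriv {s : ℝ} (hs : 0 < s) :
    MeasureTheory.IntegrableOn (fun x => x ^ (s - 1) * fermiWeightDeriv x) (Set.Ioi 0) :=
  integrableOn_rpow_mul_of_le_exp hs continuous_fermiWeightDeriv.continuousOn (C := 1)
    fun x _ => by
      rw [abs_of_nonneg (fermiWeightDeriv_nonneg x), one_mul]; exact fermiWeightDeriv_le x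

/-- The factor `exp (-x)` must survive so that the bound can be integrated against `x ^ (s - 1)`.
With `a = exp x` and `w = exp (-η)` the remainder is an explicit fraction over `(a w + 1) (a + 1)²`.
Its numerator is at most `3 η² (a + 1)²`, and `1 / (a w + 1) ≤ e / a` because `w ≥ 1 / e`. -/
theorem abs_fermiWeight_sub_le {η : ℝ} (hη : |η| ≤ 1) (x : ℝ) :
    |fermiWeight η x - fermiWeight 0 x - η * fermiWeightDeriv x| ≤
      (3 * Real.exp 1 * η ^ 2) * Real.exp (-x) := by
  set a := Real.exp x with ha
  set w := Real.exp (-η) with hw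
  have ha0 : 0 < a := Real.exp_pos x
  have hw0 : 0 < w := Real.exp_pos _
  have hwe : 1 ≤ Real.exp 1 * w := by
    rw [hw, ← Real.exp_add]; exact Real.one_le_exp (by linarith [abs_le.mp hη])
  have h2 : |w - 1 - -η| ≤ (-η) ^ 2 :=
    Real.abs_exp_sub_one_sub_id_le (by rwa [abs_neg])
  have h1 : |w - 1| ≤ 2 * |(-η)| := Real.abs_exp_sub_one_le (by rwa [abs_neg])
  rw [abs_neg] at h1
  have key : fermiWeight η x - fermiWeight 0 x - η * fermiWeightDeriv x =
      (-(w - 1 - -η) * (a * (a + 1)) - η * (w - 1) * a ^ 2) / ((a * w + 1) * (a + 1) ^ 2) := by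
    have : Real.exp (x - η) = a * w := by rw [ha, hw, ← Real.exp_add]; rfl
    unfold fermiWeight fermiWeightDeriv
    rw [this, sub_zero, ← ha]
    field_simp
    ring
  rw [key, abs_div, abs_of_pos (show 0 < (a * w + 1) * (a + 1) ^ 2 by positivity),
    div_le_iff₀ (by positivity), Real.exp_neg, ← ha]
  have hnum : |-(w - 1 - -η) * (a * (a + 1)) - η * (w - 1) * a ^ 2| ≤
      3 * η ^ 2 * (a + 1) ^ 2 := by
    calc _ ≤ |-(w - 1 - -η) * (a * (a + 1))| + |η * (w - 1) * a ^ 2| := abs_sub _ _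
      _ = |w - 1 - -η| * (a * (a + 1)) + |η| * |w - 1| * a ^ 2 := by
          rw [abs_mul, abs_neg, abs_mul (η * _), abs_mul η, abs_of_pos (show 0 < a * (a + 1) by positivity),
            abs_of_pos (show 0 < a ^ 2 by positivity)]
      _ ≤ (-η) ^ 2 * (a * (a + 1)) + |η| * (2 * |η|) * a ^ 2 := by gcongr
      _ = η ^ 2 * (a * (a + 1)) + 2 * η ^ 2 * a ^ 2 := by rw [← sq_abs η]; ring_nf; simp; ring
      _ ≤ _ := by nlinarith [mul_nonneg (sq_nonneg η) ha0.le, sq_nonneg η]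
  refine hnum.trans ?_
  have : (1 : ℝ) ≤ Real.exp 1 * a⁻¹ * (a * w + 1) := by
    have h3 : Real.exp 1 * a⁻¹ * (a * w + 1) = Real.exp 1 * w + Real.exp 1 * a⁻¹ := by
      field_simp
    have : 0 < Real.exp 1 * a⁻¹ := by positivity
    linarith
  calc _ = 3 * η ^ 2 * (a + 1) ^ 2 * 1 := by ring
    _ ≤ 3 * η ^ 2 * (a + 1) ^ 2 * (Real.exp 1 * a⁻¹ * (a * w + 1)) := by gcongr
    _ = _ := by ring

/-- Second order Taylor estimate of the Fermi-Dirac function at `η = 0`. -/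
theorem abs_fermiJ_sub_le {s : ℝ} (hs : 0 < s) {η : ℝ} (hη : |η| ≤ 1) :
    |fermiJ s η - fermiJ s 0 - η * fermiJDeriv s| ≤
      (3 * Real.exp 1 * Real.Gamma s) * η ^ 2 := by
  have h := abs_setIntegral_rpow_mul_le hs fun x _ => abs_fermiWeight_sub_le hη x
  have e : ∫ x in Set.Ioi (0 : ℝ), x ^ (s - 1) *
      (fermiWeight η x - fermiWeight 0 x - η * fermiWeightDeriv x) =
      fermiJ s η - fermiJ s 0 - η * fermiJDeriv s := by
    unfold fermiJ fermiJDeriv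
    have h0 := integrableOn_rpow_mul_fermiWeight hs 0
    have h1 := integrableOn_rpow_mul_fermiWeight hs η
    have h2 := (integrableOn_rpow_mul_fermiWeightDeriv hs).const_mul η
    have h01 : MeasureTheory.IntegrableOn
        (fun x => x ^ (s - 1) * fermiWeight η x - x ^ (s - 1) * fermiWeight 0 x) (Set.Ioi 0) :=
      h1.sub h0
    rw [← MeasureTheory.integral_const_mul, ← MeasureTheory.integral_sub h1 h0,
      ← MeasureTheory.integral_sub h01 h2]
    refine MeasureTheory.integral_congr_ae (.of_forall fun x => ?_)
    simp only
    ring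
  rw [e] at h
  linarith

/-! ### Values at `η = 0`: Mellin transform and zeta function -/

/-- The odd indices `n = 2k + 1` carry the even integers `n + 1` and sum to `2 ^ (-s) ζ(s)`;
flipping their sign subtracts this twice from `ζ(s)`. -/
theorem hasSum_alternating_zeta {s : ℂ} (hs : 1 < s.re) :
    HasSum (fun n : ℕ => (-1 : ℂ) ^ n / ((n : ℂ) + 1) ^ s) ((1 - 2 ^ (1 - s)) * riemannZeta s) := by
  set f : ℕ → ℂ := fun n => 1 / ((n : ℂ) + 1) ^ s with hf
  have hsum : Summable f := by
    have := (summable_nat_add_iff 1).mpr (Complex.summable_one_div_nat_cpow.mpr hs)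
    simpa [hf] using this
  have htot : HasSum f (riemannZeta s) := by
    rw [zeta_eq_tsum_one_div_nat_add_one_cpow hs]; exact hsum.hasSum
  have hodd : HasSum (fun k => f (2 * k + 1)) (2 ^ (-s) * riemannZeta s) := by
    refine (htot.mul_left (2 ^ (-s))).congr_fun fun k => ?_
    have h : (((2 * k + 1 : ℕ) : ℂ) + 1) = ((2 : ℝ) : ℂ) * ((k + 1 : ℝ) : ℂ) := by
      push_cast; ring
    simp only [hf]
    rw [h, Complex.mul_cpow_ofReal_nonneg (by norm_num) (by positivity), Complex.cpow_neg]
    push_cast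
    field_simp
  have heven : Summable (fun k => f (2 * k)) :=
    hsum.comp_injective (mul_right_injective₀ two_ne_zero)
  obtain ⟨A, hA⟩ := heven
  have hAB := (hA.even_add_odd hodd).unique htot
  have hval : (1 - 2 ^ (1 - s)) * riemannZeta s = A + -(2 ^ (-s) * riemannZeta s) := by
    rw [sub_eq_add_neg 1 s, Complex.cpow_add _ _ two_ne_zero, Complex.cpow_one]
    linear_combination -hAB
  rw [hval]
  refine HasSum.even_add_odd (f := fun n : ℕ => (-1 : ℂ) ^ n / ((n : ℂ) + 1) ^ s) ?_ ?_
  · refine hA.congr_fun fun k => ?_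
    simp [hf, pow_mul]
  · refine hodd.neg.congr_fun fun k => ?_
    simp [hf, pow_succ, pow_mul, neg_div]

theorem hasSum_fermiWeight {x : ℝ} (hx : 0 < x) :
    HasSum (fun n : ℕ => (-1 : ℂ) ^ n * Real.exp (-((n : ℝ) + 1) * x)) (fermiWeight 0 x : ℂ) := by
  have h1 : ‖-Real.exp (-x)‖ < 1 := by
    rw [norm_neg, Real.norm_eq_abs, Real.abs_exp]; simpa using hx
  have h := (hasSum_geometric_of_norm_lt_one h1).mul_left (Real.exp (-x))
  have h2 : Real.exp (-x) * (1 - -Real.exp (-x))⁻¹ = fermiWeight 0 x := by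
    unfold fermiWeight
    rw [sub_zero, Real.exp_neg]
    have := Real.exp_pos x
    rw [sub_neg_eq_add]
    field_simp
  rw [h2] at h
  refine (Complex.hasSum_ofReal.mpr h).congr_fun fun n => ?_
  have : Real.exp (-((n : ℝ) + 1) * x) = Real.exp (-x) * Real.exp (-x) ^ n := by
    rw [← Real.exp_nat_mul, ← Real.exp_add]; ring_nf
  rw [this, neg_pow]
  push_cast
  ring

theorem mellin_fermiWeight_of_one_lt_re {s : ℂ} (hs : 1 < s.re) :
    mellin (fun x => (fermiWeight 0 x : ℂ)) s =
      (1 - 2 ^ (1 - s)) * Complex.Gamma s * riemannZeta s := by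
  have h := hasSum_mellin (a := fun n : ℕ => (-1 : ℂ) ^ n) (p := fun n : ℕ => (n : ℝ) + 1)
    (F := fun x => (fermiWeight 0 x : ℂ)) (s := s) (fun n => Or.inr (by positivity))
    (by linarith) (fun t ht => hasSum_fermiWeight ht) (by
      have := (summable_nat_add_iff 1).mpr (Real.summable_one_div_nat_rpow.mpr hs)
      simpa using this)
  have h' := (hasSum_alternating_zeta hs).mul_left (Complex.Gamma s)
  have e := h.unique (h'.congr_fun fun n => by push_cast; ring)
  rw [e]; ring

theorem differentiableAt_mellin_fermiWeight {s : ℂ} (hs : 0 < s.re) :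
    DifferentiableAt ℂ (mellin (fun x => (fermiWeight 0 x : ℂ))) s := by
  have hc : Continuous (fun x => (fermiWeight 0 x : ℂ)) :=
    Complex.continuous_ofReal.comp (continuous_fermiWeight 0)
  refine mellin_differentiableAt_of_isBigO_rpow_exp (a := 1) (b := 0) one_pos
    (hc.locallyIntegrable.locallyIntegrableOn _) ?_ ?_ hs
  · refine IsBigO.of_bound 1 (.of_forall fun x => ?_)
    have := fermiWeight_le 0 x
    rw [Complex.norm_real, Real.norm_of_nonneg (fermiWeight_nonneg 0 x), Real.norm_eq_abs,
      Real.abs_exp]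
    simpa using this
  · simp only [neg_zero, Real.rpow_zero]
    exact (hc.continuousAt.mono_left nhdsWithin_le_nhds).isBigO_one ℝ

/-- Termwise integration of the geometric series needs `1 < re s`, but `s = (D - 2) / 2` lies in
`(0, 1)` when `2 < D < 4`. The identity theorem on the half-plane `0 < re s` extends the formula;
multiplying by `z - 1` first removes the pole of zeta. -/
theorem mellin_fermiWeight {s : ℂ} (hs : 0 < s.re) (hs1 : s ≠ 1) :
    mellin (fun x => (fermiWeight 0 x : ℂ)) s =
      (1 - 2 ^ (1 - s)) * Complex.Gamma s * riemannZeta s := by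
  set U : Set ℂ := {z | 0 < z.re}
  have hU : IsOpen U := isOpen_lt continuous_const Complex.continuous_re
  have hl : DifferentiableOn ℂ (fun z => (z - 1) * mellin (fun x => (fermiWeight 0 x : ℂ)) z) U :=
    fun z hz => (DifferentiableAt.mul (by fun_prop)
      (differentiableAt_mellin_fermiWeight hz)).differentiableWithinAt
  have hr : DifferentiableOn ℂ
      (fun z : ℂ => (1 - 2 ^ (1 - z)) * Complex.Gamma z * riemannZeta₁ z) U := by
    intro z hz
    have hΓ : DifferentiableAt ℂ Complex.Gamma z := by
      refine Complex.differentiableAt_Gamma z fun n hn => ?_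
      have hz : 0 < z.re := hz
      rw [hn] at hz
      simp at hz
      linarith [(Nat.cast_nonneg n : (0 : ℝ) ≤ n)]
    have h2 : DifferentiableAt ℂ (fun z : ℂ => (2 : ℂ) ^ (1 - z)) z :=
      DifferentiableAt.const_cpow (by fun_prop) (Or.inl two_ne_zero)
    exact ((((differentiableAt_const _).sub h2).mul hΓ).mul
      differentiable_riemannZeta₁.differentiableAt).differentiableWithinAt
  have key := (hl.analyticOnNhd hU).eqOn_of_preconnected_of_eventuallyEq (hr.analyticOnNhd hU)
    (convex_halfSpace_re_gt 0).isPreconnected (z₀ := 2) (by simp [U]) (by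
      have : {z : ℂ | 1 < z.re} ∈ 𝓝 (2 : ℂ) :=
        (isOpen_lt continuous_const Complex.continuous_re).mem_nhds (by simp)
      filter_upwards [this] with z hz
      have hz1 : z ≠ 1 := by rintro rfl; simp at hz
      rw [mellin_fermiWeight_of_one_lt_re hz, riemannZeta_eq_inv_sub_mul hz1]
      have := sub_ne_zero.mpr hz1
      field_simp) hs
  simp only at key
  have := sub_ne_zero.mpr hs1
  rw [riemannZeta_eq_inv_sub_mul hs1]
  field_simp
  linear_combination key

/-- The Fermi-Dirac integral at zero reduced chemical potential, for every real `s > 0`, `s ≠ 1`. -/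
theorem fermiJ_zero {s : ℝ} (hs : 0 < s) (hs1 : s ≠ 1) :
    fermiJ s 0 = (1 - (2 : ℝ) ^ (1 - s)) * Real.Gamma s * realZeta s := by
  have h := mellin_fermiWeight (s := s) (by simpa using hs) (by exact_mod_cast hs1)
  rw [← ofReal_realZeta, Complex.Gamma_ofReal] at h
  have e : mellin (fun x => (fermiWeight 0 x : ℂ)) s = ((fermiJ s 0 : ℝ) : ℂ) := by
    unfold mellin fermiJ
    rw [← integral_complex_ofReal]
    refine MeasureTheory.setIntegral_congr_fun measurableSet_Ioi fun x hx => ?_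
    have hx : 0 < x := hx
    simp only [smul_eq_mul, Complex.ofReal_mul]
    rw [Complex.ofReal_cpow hx.le]
    simp
  rw [e] at h
  have h2 : ((2 : ℂ) ^ (1 - (s : ℂ))) = (((2 : ℝ) ^ (1 - s) : ℝ) : ℂ) := by
    rw [Complex.ofReal_cpow (by norm_num)]; simp
  rw [h2] at h
  exact_mod_cast h

/-! ### The `η`-derivative, and the exceptional case `s = 1` -/

theorem hasDerivAt_neg_fermiWeight (x : ℝ) :
    HasDerivAt (fun x => -fermiWeight 0 x) (fermiWeightDeriv x) x := by
  have h : HasDerivAt (fun x => -(Real.exp x + 1)⁻¹) (- (-Real.exp x / (Real.exp x + 1) ^ 2)) x :=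
    (((Real.hasDerivAt_exp x).add_const 1).inv (by positivity)).neg
  convert h using 1
  · ext y; simp [fermiWeight]
  · unfold fermiWeightDeriv; ring

theorem tendsto_fermiWeight_atTop : Tendsto (fermiWeight 0) atTop (𝓝 0) := by
  refine squeeze_zero (fermiWeight_nonneg 0) (fun x => ?_)
    (Real.tendsto_exp_atBot.comp tendsto_neg_atTop_atBot)
  simpa using fermiWeight_le 0 x

theorem fermiJDeriv_one : fermiJDeriv 1 = 1 / 2 := by
  have h := MeasureTheory.integral_Ioi_of_hasDerivAt_of_tendsto' (a := 0)
    (fun x _ => hasDerivAt_neg_fermiWeight x)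
    (by simpa using integrableOn_rpow_mul_fermiWeightDeriv one_pos)
    (tendsto_fermiWeight_atTop.neg)
  unfold fermiJDeriv
  simp only [sub_self, Real.rpow_zero, one_mul, h]
  norm_num [fermiWeight]

/-- At `s = 1` the zeta formula degenerates (a zero against a pole), but the weight has the
antiderivative `-log (1 + exp (-x))`. -/
theorem fermiJ_one_zero : fermiJ 1 0 = Real.log 2 := by
  have hd (x : ℝ) : HasDerivAt (fun x => -Real.log (1 + Real.exp (-x))) (fermiWeight 0 x) x := by
    have h : HasDerivAt (fun x => -Real.log (1 + Real.exp (-x)))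
        (-((Real.exp (-x) * -1) / (1 + Real.exp (-x)))) x :=
      ((((hasDerivAt_neg x).exp).const_add 1).log (by positivity)).neg
    convert h using 1
    unfold fermiWeight
    rw [sub_zero, Real.exp_neg]
    have := Real.exp_pos x
    field_simp
  have ht : Tendsto (fun x => -Real.log (1 + Real.exp (-x))) atTop (𝓝 0) := by
    have h1 : Tendsto (fun x : ℝ => 1 + Real.exp (-x)) atTop (𝓝 (1 + 0)) :=
      (Real.tendsto_exp_atBot.comp tendsto_neg_atTop_atBot).const_add 1
    simpa using (h1.log (by norm_num)).neg
  have h := MeasureTheory.integral_Ioi_of_hasDerivAt_of_tendsto' (a := 0) (fun x _ => hd x)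
    (by simpa using integrableOn_rpow_mul_fermiWeight one_pos 0) ht
  unfold fermiJ
  simp only [sub_self, Real.rpow_zero, one_mul, h]
  norm_num

/-- Since the weight depends on `x - η` only, its `η`-derivative is minus its `x`-derivative;
integrate by parts. The boundary term at `0` vanishes because `s > 1`. -/
theorem fermiJDeriv_eq {s : ℝ} (hs : 1 < s) : fermiJDeriv s = (s - 1) * fermiJ (s - 1) 0 := by
  have hu (x : ℝ) (hx : x ∈ Set.Ioi (0 : ℝ)) :
      HasDerivAt (fun x : ℝ => x ^ (s - 1)) ((s - 1) * x ^ (s - 1 - 1)) x :=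
    Real.hasDerivAt_rpow_const (Or.inl (ne_of_gt hx))
  have hint := ((integrableOn_rpow_mul_fermiWeight (sub_pos.mpr hs) 0).const_mul (s - 1)).neg
  have h := MeasureTheory.integral_Ioi_mul_deriv_eq_deriv_mul (a := 0) (a' := 0) (b' := 0) hu
    (fun x _ => hasDerivAt_neg_fermiWeight x)
    (integrableOn_rpow_mul_fermiWeightDeriv (by linarith)) (by
      refine hint.congr (.of_forall fun x => ?_)
      simp only [Pi.mul_apply, Pi.neg_apply]; ring) (by
      have h1 : Tendsto (fun x : ℝ => x ^ (s - 1)) (𝓝[>] 0) (𝓝 0) := by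
        have := (Real.continuousAt_rpow_const 0 (s - 1) (Or.inr (by linarith))).tendsto
        rw [Real.zero_rpow (by linarith)] at this
        exact this.mono_left nhdsWithin_le_nhds
      have h2 := ((continuous_fermiWeight 0).neg.tendsto 0).mono_left
        (nhdsWithin_le_nhds (s := Set.Ioi 0))
      have h3 := h1.mul h2
      rw [zero_mul] at h3
      exact h3) (by
      have h1 := tendsto_rpow_mul_exp_neg_mul_atTop_nhds_zero (s - 1) 1 one_pos
      refine squeeze_zero_norm' ?_ h1
      filter_upwards [eventually_gt_atTop 0] with x hx
      have h3 := Real.rpow_nonneg hx.le (s - 1)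
      simp only [Pi.mul_apply]
      rw [norm_mul, norm_neg, Real.norm_of_nonneg h3, Real.norm_of_nonneg (fermiWeight_nonneg 0 x)]
      refine mul_le_mul_of_nonneg_left ?_ h3
      simpa using fermiWeight_le 0 x)
  unfold fermiJDeriv fermiJ
  rw [h, ← MeasureTheory.integral_const_mul, sub_zero, zero_sub, ← MeasureTheory.integral_neg]
  refine MeasureTheory.integral_congr_ae (.of_forall fun x => ?_)
  simp only
  ring

/-! ### Change of variables to the kinetic energy -/

/-- The momentum `p` of a particle whose kinetic energy is `m t x`. -/
def momentumOfEnergy (m t x : ℝ) : ℝ := m * √(t * x) * √(t * x + 2)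

theorem momentumOfEnergy_eq (m : ℝ) {t x : ℝ} (ht : 0 ≤ t) (hx : 0 ≤ x) :
    momentumOfEnergy m t x = m * √(t * x * (t * x + 2)) := by
  unfold momentumOfEnergy
  rw [mul_assoc, ← Real.sqrt_mul (by positivity)]

/-- The energy relation gives injectivity and surjectivity of the substitution, and the form of the
Fermi factor. -/
theorem momentumOfEnergy_sq (m : ℝ) {t x : ℝ} (ht : 0 ≤ t) (hx : 0 ≤ x) :
    momentumOfEnergy m t x ^ 2 + m ^ 2 = (m * (1 + t * x)) ^ 2 := by
  rw [momentumOfEnergy_eq m ht hx, mul_pow, Real.sq_sqrt (by positivity)]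
  ring

theorem momentumOfEnergy_pos {m t x : ℝ} (hm : 0 < m) (ht : 0 < t) (hx : 0 < x) :
    0 < momentumOfEnergy m t x := by
  unfold momentumOfEnergy; positivity

theorem hasDerivAt_momentumOfEnergy (m : ℝ) {t x : ℝ} (ht : 0 < t) (hx : 0 < x) :
    HasDerivAt (momentumOfEnergy m t) (m * t * (1 + t * x) / (√(t * x) * √(t * x + 2))) x := by
  have h1 : HasDerivAt (fun x => t * x * (t * x + 2)) (t * (t * x + 2) + t * x * t) x := by
    have h0 : HasDerivAt (fun x => t * x) t x := by
      simpa using (hasDerivAt_id x).const_mul t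
    exact h0.mul (h0.add_const 2)
  have h2 := (h1.sqrt (by positivity)).const_mul m
  refine (h2.congr_of_eventuallyEq ?_).congr_deriv ?_
  · filter_upwards [eventually_gt_nhds hx] with y hy
    exact momentumOfEnergy_eq m ht.le hy.le
  · rw [Real.sqrt_mul (by positivity)]
    field_simp
    ring

theorem injOn_momentumOfEnergy {m t : ℝ} (hm : 0 < m) (ht : 0 < t) :
    Set.InjOn (momentumOfEnergy m t) (Set.Ioi 0) := by
  intro x hx y hy h
  have hx : 0 < x := hx
  have hy : 0 < y := hy
  have h1 := momentumOfEnergy_sq m ht.le hx.le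
  rw [h, momentumOfEnergy_sq m ht.le hy.le, pow_left_inj₀ (by positivity) (by positivity)
    two_ne_zero] at h1
  have := mul_left_cancel₀ hm.ne' h1
  have : t * x = t * y := by linarith
  exact mul_left_cancel₀ ht.ne' this

theorem image_momentumOfEnergy {m t : ℝ} (hm : 0 < m) (ht : 0 < t) :
    momentumOfEnergy m t '' Set.Ioi 0 = Set.Ioi 0 := by
  ext p
  refine ⟨?_, fun hp => ?_⟩
  · rintro ⟨x, hx, rfl⟩
    exact momentumOfEnergy_pos hm ht hx
  · have hp : 0 < p := hp
    have hlt : 1 < √((p / m) ^ 2 + 1) := by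
      rw [Real.lt_sqrt (by norm_num)]
      have : 0 < (p / m) ^ 2 := by positivity
      linarith
    refine ⟨(√((p / m) ^ 2 + 1) - 1) / t, div_pos (by linarith) ht, ?_⟩
    have hx : 0 < (√((p / m) ^ 2 + 1) - 1) / t := div_pos (by linarith) ht
    have h := momentumOfEnergy_sq m ht.le hx.le
    have e : t * ((√((p / m) ^ 2 + 1) - 1) / t) = √((p / m) ^ 2 + 1) - 1 := by field_simp
    rw [e, add_sub_cancel, mul_pow, Real.sq_sqrt (by positivity)] at h
    have h' : momentumOfEnergy m t ((√((p / m) ^ 2 + 1) - 1) / t) ^ 2 = p ^ 2 := by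
      have : m ^ 2 * ((p / m) ^ 2 + 1) = p ^ 2 + m ^ 2 := by field_simp
      linarith
    exact (pow_left_inj₀ (momentumOfEnergy_pos hm ht hx).le hp.le two_ne_zero).mp h'

theorem fermiDirac_momentumOfEnergy {m T x : ℝ} (hm : 0 < m) (hT : 0 < T) (hx : 0 < x) (μ : ℝ) :
    fermiDirac m μ T (momentumOfEnergy m (T / m) x) = fermiWeight ((μ - m) / T) x := by
  have ht : 0 < T / m := div_pos hT hm
  unfold fermiDirac fermiWeight
  rw [momentumOfEnergy_sq m ht.le hx.le, Real.sqrt_sq (by positivity)]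
  congr 3
  field_simp
  ring

/-- The denominator of the Jacobian lowers the exponents of `t x` and `t x + 2` in `p ^ (D - 1)`
from `(D-1)/2` to `(D-2)/2`; with `y² = t x` the factors `1 + t x`, `(t x + 2) ^ ((D-2)/2)` and `G
p` assemble into `F(y)`. -/
theorem abs_deriv_mul_fermiDiracIntegrand {m T x : ℝ} (hm : 0 < m) (hT : 0 < T) (hx : 0 < x)
    (D : ℝ) (G : ℝ → ℝ) (μ : ℝ) :
    |m * (T / m) * (1 + T / m * x) / (√(T / m * x) * √(T / m * x + 2))| •
        fermiDiracIntegrand D G m μ T (momentumOfEnergy m (T / m) x) =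
      m ^ D * (T / m) ^ (D / 2) * (x ^ (D / 2 - 1) *
        (expansionFunction D G m √(T / m * x) * fermiWeight ((μ - m) / T) x)) := by
  unfold fermiDiracIntegrand
  rw [fermiDirac_momentumOfEnergy hm hT hx, smul_eq_mul]
  have ht : 0 < T / m := div_pos hT hm
  set t := T / m
  have hu : 0 < t * x := by positivity
  rw [abs_of_nonneg (by positivity)]
  unfold expansionFunction
  rw [Real.sq_sqrt hu.le]
  have hpow : momentumOfEnergy m t x ^ (D - 1) / (√(t * x) * √(t * x + 2)) * (m * t) =
      m ^ D * t ^ (D / 2) * x ^ (D / 2 - 1) * (t * x + 2) ^ ((D - 2) / 2) := by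
    have h1 : momentumOfEnergy m t x ^ (D - 1) =
        m ^ (D - 1) * (t * x) ^ ((D - 1) / 2) * (t * x + 2) ^ ((D - 1) / 2) := by
      unfold momentumOfEnergy
      rw [Real.mul_rpow (by positivity) (by positivity), Real.mul_rpow hm.le (by positivity),
        Real.sqrt_eq_rpow, Real.sqrt_eq_rpow, ← Real.rpow_mul hu.le,
        ← Real.rpow_mul (by positivity)]
      ring_nf
    have h2 : (t * x) ^ ((D - 1) / 2) = t ^ (D / 2 - 1) * x ^ (D / 2 - 1) * √(t * x) := by
      rw [← Real.mul_rpow ht.le hx.le, Real.sqrt_eq_rpow, ← Real.rpow_add hu]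
      ring_nf
    have h3 : (t * x + 2) ^ ((D - 1) / 2) = (t * x + 2) ^ ((D - 2) / 2) * √(t * x + 2) := by
      rw [Real.sqrt_eq_rpow, ← Real.rpow_add (by positivity)]
      ring_nf
    have h4 : m ^ (D - 1) * m = m ^ D := by
      nth_rw 2 [← Real.rpow_one m]
      rw [← Real.rpow_add hm]; ring_nf
    have h5 : t ^ (D / 2 - 1) * t = t ^ (D / 2) := by
      nth_rw 2 [← Real.rpow_one t]
      rw [← Real.rpow_add ht]; ring_nf
    rw [h1, h2, h3, ← h4, ← h5]
    field_simp
  have hG : G (m * √(t * x) * √(t * x + 2)) = G (momentumOfEnergy m t x) := rfl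
  rw [hG]
  linear_combination (1 + t * x) * G (momentumOfEnergy m t x) * fermiWeight ((μ - m) / T) x * hpow

theorem fermiDiracIntegral_eq {m T : ℝ} (hm : 0 < m) (hT : 0 < T) (D : ℝ) (G : ℝ → ℝ) (μ : ℝ) :
    fermiDiracIntegral D G m μ T = m ^ D * (T / m) ^ (D / 2) *
      ∫ x in Set.Ioi (0 : ℝ), x ^ (D / 2 - 1) *
        (expansionFunction D G m √(T / m * x) * fermiWeight ((μ - m) / T) x) := by
  have ht : 0 < T / m := div_pos hT hm
  unfold fermiDiracIntegral
  rw [← MeasureTheory.integral_const_mul]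
  nth_rw 1 [← image_momentumOfEnergy hm ht]
  rw [MeasureTheory.integral_image_eq_integral_abs_deriv_smul measurableSet_Ioi
    (fun x hx => (hasDerivAt_momentumOfEnergy m ht hx).hasDerivWithinAt)
    (injOn_momentumOfEnergy hm ht)]
  exact MeasureTheory.setIntegral_congr_fun measurableSet_Ioi fun x hx =>
    abs_deriv_mul_fermiDiracIntegrand hm hT hx D G μ

theorem integrableOn_fermiDiracIntegrand {m T : ℝ} (hm : 0 < m) (hT : 0 < T) {D : ℝ}
    {G : ℝ → ℝ} {μ : ℝ}
    (h : MeasureTheory.IntegrableOn (fun x => x ^ (D / 2 - 1) *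
      (expansionFunction D G m √(T / m * x) * fermiWeight ((μ - m) / T) x)) (Set.Ioi 0)) :
    MeasureTheory.IntegrableOn (fermiDiracIntegrand D G m μ T) (Set.Ioi 0) := by
  have ht : 0 < T / m := div_pos hT hm
  rw [← image_momentumOfEnergy hm ht,
    MeasureTheory.integrableOn_image_iff_integrableOn_abs_deriv_smul measurableSet_Ioi
    (fun x hx => (hasDerivAt_momentumOfEnergy m ht hx).hasDerivWithinAt)
    (injOn_momentumOfEnergy hm ht)]
  exact MeasureTheory.IntegrableOn.congr_fun (h.const_mul (m ^ D * (T / m) ^ (D / 2)))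
    (fun x hx => (abs_deriv_mul_fermiDiracIntegrand hm hT hx D G μ).symm) measurableSet_Ioi

theorem chemicalPotential_sub_div {m T : ℝ} (hm : 0 < m) (hT : 0 < T) (B γ : ℝ) :
    (chemicalPotential m B γ T - m) / T = B * (T / m) ^ γ := by
  unfold chemicalPotential
  rw [Real.rpow_add (div_pos hT hm), Real.rpow_one]
  field_simp
  ring

/-! ### Regularity, growth and Taylor expansion of `F` -/

theorem contDiffOn_expansionFunction {G : ℝ → ℝ} (hG : ContDiffOn ℝ 2 G (Set.Ici 0)) {m : ℝ}
    (hm : 0 < m) (D : ℝ) : ContDiffOn ℝ 2 (expansionFunction D G m) (Set.Ici 0) := by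
  have h2 (y : ℝ) : y ^ 2 + 2 ≠ 0 := by positivity
  have hp : ContDiff ℝ 2 fun y : ℝ => y ^ 2 + 2 := by fun_prop
  have h3 : ContDiff ℝ 2 fun y : ℝ => m * y * √(y ^ 2 + 2) :=
    (by fun_prop : ContDiff ℝ 2 fun y : ℝ => m * y).mul (hp.sqrt h2)
  have h4 : ContDiffOn ℝ 2 (fun y : ℝ => G (m * y * √(y ^ 2 + 2))) (Set.Ici 0) :=
    hG.comp h3.contDiffOn fun y (hy : 0 ≤ y) =>
      show (0 : ℝ) ≤ m * y * √(y ^ 2 + 2) by positivity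
  have h5 : ContDiff ℝ 2 fun y : ℝ => (y ^ 2 + 1) * (y ^ 2 + 2) ^ ((D - 2) / 2) :=
    (by fun_prop : ContDiff ℝ 2 fun y : ℝ => y ^ 2 + 1).mul (hp.rpow_const_of_ne h2)
  exact h5.contDiffOn.mul h4

theorem exists_abs_expansionFunction_le {G : ℝ → ℝ} (hG : PolynomiallyBounded G) {m : ℝ}
    (hm : 0 < m) (D : ℝ) :
    ∃ (C : ℝ) (N : ℕ), 0 ≤ C ∧ ∀ y, 0 ≤ y → |expansionFunction D G m y| ≤ C * (1 + y) ^ N := by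
  obtain ⟨C, N, hC⟩ := hG
  -- A natural exponent may replace the real one because the base `y² + 2` is at least `1`.
  obtain ⟨n, hn⟩ := exists_nat_ge ((D - 2) / 2)
  refine ⟨2 ^ n * (2 * |C| * (1 + 2 * m) ^ N), 2 + 2 * n + 2 * N, by positivity, fun y hy => ?_⟩
  have h1 : y ^ 2 + 1 ≤ (1 + y) ^ 2 := by nlinarith
  have hle : y ^ 2 + 2 ≤ 2 * (1 + y) ^ 2 := by nlinarith
  have h2 : (y ^ 2 + 2) ^ ((D - 2) / 2) ≤ (2 * (1 + y) ^ 2) ^ n := by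
    calc _ ≤ (y ^ 2 + 2) ^ (n : ℝ) := Real.rpow_le_rpow_of_exponent_le (by nlinarith) hn
      _ = (y ^ 2 + 2) ^ n := Real.rpow_natCast _ _
      _ ≤ _ := by gcongr
  have h3 : |G (m * y * √(y ^ 2 + 2))| ≤ 2 * |C| * ((1 + 2 * m) * (1 + y) ^ 2) ^ N := by
    set p := m * y * √(y ^ 2 + 2) with hp
    have hp0 : 0 ≤ p := by positivity
    have hs : √(y ^ 2 + 2) ≤ 2 * (1 + y) := by
      rw [Real.sqrt_le_left (by positivity)]; nlinarith
    have hp1 : 1 + p ≤ (1 + 2 * m) * (1 + y) ^ 2 := by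
      have : p ≤ m * y * (2 * (1 + y)) := by rw [hp]; gcongr
      nlinarith [mul_nonneg hm.le hy]
    calc |G p| ≤ C * (1 + p ^ N) := hC p hp0
      _ ≤ |C| * (1 + p ^ N) := by gcongr; exact le_abs_self C
      _ ≤ |C| * ((1 + p) ^ N + (1 + p) ^ N) := by
          gcongr
          · exact one_le_pow₀ (by linarith)
          · linarith
      _ = 2 * |C| * (1 + p) ^ N := by ring
      _ ≤ _ := by gcongr
  unfold expansionFunction
  rw [abs_mul, abs_of_nonneg (by positivity)]
  calc _ ≤ (1 + y) ^ 2 * (2 * (1 + y) ^ 2) ^ n *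
        (2 * |C| * ((1 + 2 * m) * (1 + y) ^ 2) ^ N) := by gcongr
    _ = _ := by simp only [mul_pow, ← pow_mul, pow_add]; ring

/-- First order Taylor estimate of `F(y, m)` at `y = 0`, uniform on `[0, ∞)`. -/
theorem exists_abs_expansionFunction_sub_le {G : ℝ → ℝ} (hG : ContDiffOn ℝ 2 G (Set.Ici 0))
    (hb : PolynomiallyBounded G) {m : ℝ} (hm : 0 < m) (D : ℝ) :
    ∃ (K : ℝ) (l : ℕ), 0 ≤ K ∧ ∀ y, 0 ≤ y →
      |expansionFunction D G m y - expansionCoeff D G m 0 - expansionCoeff D G m 1 * y| ≤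
        K * (y ^ 2 + (y ^ 2) ^ (l + 1)) := by
  have hF := contDiffOn_expansionFunction hG hm D
  obtain ⟨C, N, hC0, hC⟩ := exists_abs_expansionFunction_le hb hm D
  obtain ⟨K, hK⟩ := exists_taylor_mean_remainder_bound (n := 1) (zero_le_one (α := ℝ))
    (f := expansionFunction D G m) (by exact_mod_cast hF.mono Set.Icc_subset_Ici_self)
  have hd : derivWithin (expansionFunction D G m) (Set.Icc 0 1) 0 = expansionCoeff D G m 1 := by
    unfold expansionCoeff
    rw [iteratedDerivWithin_one]
    have h := (hF.differentiableOn (by norm_num) 0 Set.self_mem_Ici).hasDerivWithinAt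
    rw [(h.mono Set.Icc_subset_Ici_self).derivWithin (uniqueDiffOn_Icc zero_lt_one 0 (by simp))]
    simp
  have h0 : expansionFunction D G m 0 = expansionCoeff D G m 0 := by
    simp [expansionCoeff]
  set a₀ := expansionCoeff D G m 0
  set a₁ := expansionCoeff D G m 1
  -- `|K|` serves `y ≤ 1`, by Taylor's theorem; the other summands serve `y ≥ 1`, where `1`, `y` and
  -- `y ^ N` are all at most `(y²) ^ (N + 1)`. The `+ 1` keeps this true for `N = 0`.
  refine ⟨|K| + (C * 2 ^ N + |a₀| + |a₁|), N, by positivity, fun y hy => ?_⟩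
  rcases le_total y 1 with h1 | h1
  · have h := hK y ⟨hy, h1⟩
    rw [taylorWithinEval_succ, taylor_within_zero_eval] at h
    norm_num [h0] at h
    rw [hd] at h
    have e : expansionFunction D G m y - a₀ - a₁ * y =
        expansionFunction D G m y - (a₀ + y * a₁) := by ring
    rw [e]
    refine h.trans ?_
    have : K * y ^ 2 ≤ |K| * y ^ 2 := by gcongr; exact le_abs_self K
    have h5 : 0 ≤ |K| * (y ^ 2) ^ (N + 1) := by positivity
    have h6 : 0 ≤ (C * 2 ^ N + |a₀| + |a₁|) * (y ^ 2 + (y ^ 2) ^ (N + 1)) := by positivity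
    linarith
  · set P := (y ^ 2) ^ (N + 1) with hP
    have hyN : y ^ N ≤ P := by
      rw [hP, ← pow_mul]; exact pow_le_pow_right₀ h1 (by omega)
    have hy1 : y ≤ P := by
      rw [hP, ← pow_mul]; exact le_self_pow₀ h1 (by omega)
    have hP1 : 1 ≤ P := h1.trans hy1
    have hF1 : |expansionFunction D G m y| ≤ C * 2 ^ N * P := by
      calc _ ≤ C * (1 + y) ^ N := hC y hy
        _ ≤ C * (2 * y) ^ N := by gcongr; linarith
        _ = C * 2 ^ N * y ^ N := by rw [mul_pow]; ring
        _ ≤ _ := by gcongr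
    have hA0 : |a₀| ≤ |a₀| * P := le_mul_of_one_le_right (abs_nonneg _) hP1
    have hA1 : |a₁ * y| ≤ |a₁| * P := by rw [abs_mul, abs_of_nonneg hy]; gcongr
    have h3 := abs_sub (expansionFunction D G m y) a₀
    have h4 := abs_sub (expansionFunction D G m y - a₀) (a₁ * y)
    have h5 : 0 ≤ |K| * (y ^ 2 + P) := by positivity
    have h6 : 0 ≤ (C * 2 ^ N + |a₀| + |a₁|) * y ^ 2 := by positivity
    linarith

/-! ### Integrating the expansion -/

theorem rpow_mul_pow_integral_le {s : ℝ} (hs : 0 < s) {t K M : ℝ} (l : ℕ) {f : ℝ → ℝ}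
    (hf : ContinuousOn f (Set.Ioi 0))
    (hb : ∀ x, 0 < x → |f x| ≤ K * (t * x + (t * x) ^ (l + 1)) * (M * Real.exp (-x))) :
    MeasureTheory.IntegrableOn (fun x => x ^ (s - 1) * f x) (Set.Ioi 0) ∧
      |∫ x in Set.Ioi (0 : ℝ), x ^ (s - 1) * f x| ≤
        K * M * (t * Real.Gamma (s + 1) + t ^ (l + 1) * Real.Gamma (s + (l + 1))) := by
  have hs1 : 0 < s + 1 := by linarith
  have hs2 : 0 < s + (l + 1) := by positivity
  have hi1 := (Real.GammaIntegral_convergent hs1).const_mul t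
  have hi2 := (Real.GammaIntegral_convergent hs2).const_mul (t ^ (l + 1))
  have hdom : ∀ᵐ x ∂(MeasureTheory.volume.restrict (Set.Ioi (0 : ℝ))), ‖x ^ (s - 1) * f x‖ ≤
      K * M * (t * (Real.exp (-x) * x ^ (s + 1 - 1)) +
        t ^ (l + 1) * (Real.exp (-x) * x ^ (s + (l + 1) - 1))) := by
    filter_upwards [MeasureTheory.ae_restrict_mem measurableSet_Ioi] with x hx
    have hx : 0 < x := hx
    have h := Real.rpow_nonneg hx.le (s - 1)
    have e1 : x ^ (s + 1 - 1) = x ^ (s - 1) * x := by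
      rw [add_sub_right_comm, Real.rpow_add hx, Real.rpow_one]
    have e2 : x ^ (s + (l + 1) - 1) = x ^ (s - 1) * x ^ (l + 1) := by
      rw [add_sub_right_comm, Real.rpow_add hx]
      norm_cast
    rw [Real.norm_eq_abs, abs_mul, abs_of_nonneg h, e1, e2]
    refine (mul_le_mul_of_nonneg_left (hb x hx) h).trans_eq ?_
    rw [mul_pow]; ring
  have hint := (hi1.add hi2).const_mul (K * M)
  constructor
  · refine MeasureTheory.Integrable.mono' hint ?_ hdom
    refine ContinuousOn.aestronglyMeasurable (ContinuousOn.mul ?_ hf) measurableSet_Ioi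
    exact fun x hx => (Real.continuousAt_rpow_const _ _ (Or.inl (ne_of_gt hx))).continuousWithinAt
  · rw [Real.Gamma_eq_integral hs1, Real.Gamma_eq_integral hs2, ← Real.norm_eq_abs,
      ← MeasureTheory.integral_const_mul, ← MeasureTheory.integral_const_mul,
      ← MeasureTheory.integral_add hi1 hi2, ← MeasureTheory.integral_const_mul]
    exact MeasureTheory.norm_integral_le_of_norm_le hint hdom

/-- Expansion in `t` of the Fermi-Dirac average of `F (√(t x))` when `F` has a first order Taylor
expansion at `0` with a polynomially bounded remainder. -/
theorem integral_fermiWeight_taylor {s : ℝ} (hs : 0 < s) {F : ℝ → ℝ}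
    (hF : ContinuousOn F (Set.Ici 0)) {a₀ a₁ K : ℝ} {l : ℕ} (hK : 0 ≤ K)
    (hR : ∀ y, 0 ≤ y → |F y - a₀ - a₁ * y| ≤ K * (y ^ 2 + (y ^ 2) ^ (l + 1)))
    {t : ℝ} (ht : 0 < t) (η : ℝ) :
    MeasureTheory.IntegrableOn (fun x => x ^ (s - 1) * (F √(t * x) * fermiWeight η x))
      (Set.Ioi 0) ∧
    |(∫ x in Set.Ioi (0 : ℝ), x ^ (s - 1) * (F √(t * x) * fermiWeight η x)) -
        (a₀ * fermiJ s η + a₁ * √t * fermiJ (s + 1 / 2) η)| ≤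
      K * Real.exp η * (t * Real.Gamma (s + 1) + t ^ (l + 1) * Real.Gamma (s + (l + 1))) := by
  set R : ℝ → ℝ := fun x => (F √(t * x) - a₀ - a₁ * √(t * x)) * fermiWeight η x with hRdef
  have hsq : Continuous fun x : ℝ => √(t * x) := by fun_prop
  have hRc : ContinuousOn R (Set.Ioi 0) := by
    have h1 : ContinuousOn (fun x => F √(t * x)) (Set.Ioi 0) :=
      hF.comp hsq.continuousOn fun x _ => Real.sqrt_nonneg _
    exact ((h1.sub continuousOn_const).sub (hsq.const_mul a₁ |>.continuousOn)).mul
      (continuous_fermiWeight η).continuousOn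
  obtain ⟨hRi, hRb⟩ := rpow_mul_pow_integral_le hs l (t := t) (K := K) (M := Real.exp η) hRc
    (fun x hx => by
      have h := hR √(t * x) (Real.sqrt_nonneg _)
      rw [Real.sq_sqrt (by positivity)] at h
      rw [hRdef]
      simp only
      rw [abs_mul, abs_of_nonneg (fermiWeight_nonneg η x)]
      exact mul_le_mul h (fermiWeight_le η x) (fermiWeight_nonneg η x) (by positivity))
  have h0 := (integrableOn_rpow_mul_fermiWeight hs η).const_mul a₀
  have h1 := (integrableOn_rpow_mul_fermiWeight (s := s + 1 / 2) (by linarith) η).const_mul (a₁ * √t)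
  have h01 : MeasureTheory.IntegrableOn (fun x => a₀ * (x ^ (s - 1) * fermiWeight η x) +
      a₁ * √t * (x ^ (s + 1 / 2 - 1) * fermiWeight η x)) (Set.Ioi 0) := h0.add h1
  have heq : Set.EqOn (fun x => a₀ * (x ^ (s - 1) * fermiWeight η x) +
      a₁ * √t * (x ^ (s + 1 / 2 - 1) * fermiWeight η x) + x ^ (s - 1) * R x)
      (fun x => x ^ (s - 1) * (F √(t * x) * fermiWeight η x)) (Set.Ioi 0) := by
    intro x hx
    have hx : 0 < x := hx
    -- The linear Taylor term carries `√(t x) = √t √x`, which raises `s` by `1/2`.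
    have e : x ^ (s + 1 / 2 - 1) = x ^ (s - 1) * √x := by
      rw [add_sub_right_comm, Real.rpow_add hx, Real.sqrt_eq_rpow]
    simp only [hRdef]
    rw [e, Real.sqrt_mul ht.le]
    ring
  refine ⟨MeasureTheory.IntegrableOn.congr_fun (h01.add hRi) heq measurableSet_Ioi, ?_⟩
  rw [← MeasureTheory.setIntegral_congr_fun measurableSet_Ioi heq,
    MeasureTheory.integral_add h01 hRi, MeasureTheory.integral_add h0 h1,
    MeasureTheory.integral_const_mul, MeasureTheory.integral_const_mul]
  unfold fermiJ
  rwa [add_sub_cancel_left]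

/-- The constant is uniform in `t` and `η`. The `a₁` term already has a factor `√t`, so it is
expanded in `η` only to order zero: the cross term `√t |η|` is at most `t + η²`. -/
theorem integral_fermiWeight_expansion {s : ℝ} (hs : 0 < s) {F : ℝ → ℝ}
    (hF : ContinuousOn F (Set.Ici 0)) {a₀ a₁ K : ℝ} {l : ℕ} (hK : 0 ≤ K)
    (hR : ∀ y, 0 ≤ y → |F y - a₀ - a₁ * y| ≤ K * (y ^ 2 + (y ^ 2) ^ (l + 1))) :
    ∃ C, 0 ≤ C ∧ ∀ t η, 0 < t → t ≤ 1 → |η| ≤ 1 →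
      |(∫ x in Set.Ioi (0 : ℝ), x ^ (s - 1) * (F √(t * x) * fermiWeight η x)) -
        (a₀ * (fermiJ s 0 + η * fermiJDeriv s) + a₁ * √t * fermiJ (s + 1 / 2) 0)| ≤
      C * (t + η ^ 2) := by
  have hs' : 0 < s + 1 / 2 := by linarith
  have hs1 : 0 < s + 1 := by linarith
  have hs2 : 0 < s + (l + 1) := by positivity
  have g1 := Real.Gamma_pos_of_pos hs1
  have g2 := Real.Gamma_pos_of_pos hs2
  have g3 := Real.Gamma_pos_of_pos hs
  have g4 := Real.Gamma_pos_of_pos hs'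
  set C₁ := K * Real.exp 1 * (Real.Gamma (s + 1) + Real.Gamma (s + (l + 1)))
  set C₂ := 3 * Real.exp 1 * Real.Gamma s
  set C₃ := 3 * Real.exp 1 * Real.Gamma (s + 1 / 2)
  set J := |fermiJDeriv (s + 1 / 2)|
  refine ⟨C₁ + |a₀| * C₂ + |a₁| * (C₃ + J), by positivity, fun t η ht ht1 hη => ?_⟩
  have h1 := (integral_fermiWeight_taylor hs hF hK hR ht η).2
  have h1' : K * Real.exp η *
      (t * Real.Gamma (s + 1) + t ^ (l + 1) * Real.Gamma (s + (l + 1))) ≤ C₁ * t := by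
    have : t ^ (l + 1) ≤ t := pow_le_of_le_one ht.le ht1 (by omega)
    calc _ ≤ K * Real.exp 1 * (t * Real.Gamma (s + 1) + t * Real.Gamma (s + (l + 1))) := by
          gcongr; exact (abs_le.mp hη).2
      _ = _ := by ring
  have h2 := abs_fermiJ_sub_le hs hη
  have h3 := abs_fermiJ_sub_le hs' hη
  have hst : √t ≤ 1 := Real.sqrt_le_one.mpr ht1
  have hmix : √t * |η| ≤ t + η ^ 2 := by
    nlinarith [sq_nonneg (√t - |η|), Real.sq_sqrt ht.le, sq_abs η]
  have h2' : |a₀ * (fermiJ s η - fermiJ s 0 - η * fermiJDeriv s)| ≤ |a₀| * (C₂ * η ^ 2) := by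
    rw [abs_mul]; gcongr
  have h3' : |a₁ * (√t * (fermiJ (s + 1 / 2) η - fermiJ (s + 1 / 2) 0))| ≤
      |a₁| * (C₃ * η ^ 2 + J * (t + η ^ 2)) := by
    rw [abs_mul, abs_mul, abs_of_nonneg (Real.sqrt_nonneg t)]
    gcongr
    have : |fermiJ (s + 1 / 2) η - fermiJ (s + 1 / 2) 0| ≤ C₃ * η ^ 2 + |η| * J := by
      rw [← abs_mul]
      calc _ = |(fermiJ (s + 1 / 2) η - fermiJ (s + 1 / 2) 0 - η * fermiJDeriv (s + 1 / 2)) +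
            η * fermiJDeriv (s + 1 / 2)| := by ring_nf
        _ ≤ _ := (abs_add_le _ _).trans (by gcongr)
    calc _ ≤ √t * (C₃ * η ^ 2 + |η| * J) := by gcongr
      _ = √t * (C₃ * η ^ 2) + J * (√t * |η|) := by ring
      _ ≤ 1 * (C₃ * η ^ 2) + J * (t + η ^ 2) := by gcongr
      _ = _ := by ring
  set I := ∫ x in Set.Ioi (0 : ℝ), x ^ (s - 1) * (F √(t * x) * fermiWeight η x)
  have e : I - (a₀ * (fermiJ s 0 + η * fermiJDeriv s) + a₁ * √t * fermiJ (s + 1 / 2) 0) =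
      (I - (a₀ * fermiJ s η + a₁ * √t * fermiJ (s + 1 / 2) η)) +
      a₀ * (fermiJ s η - fermiJ s 0 - η * fermiJDeriv s) +
      a₁ * (√t * (fermiJ (s + 1 / 2) η - fermiJ (s + 1 / 2) 0)) := by ring
  rw [e]
  refine (abs_add_three _ _ _).trans ?_
  have p1 : 0 ≤ C₁ * η ^ 2 := by positivity
  have p2 : 0 ≤ |a₀| * C₂ * t := by positivity
  have p3 : 0 ≤ |a₁| * C₃ * t := by positivity
  linarith

/-! ### Assembly of the asymptotic expansion -/

/-- A remainder bounded by a sum of two powers splits into one remainder for each power. -/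
theorem exists_isBigO_add_of_abs_le {m : ℝ} (hm : 0 < m) {E : ℝ → ℝ} {C α β : ℝ} (hC : 0 ≤ C)
    (hE : ∀ᶠ T in 𝓝[>] (0 : ℝ), |E T| ≤ C * ((T / m) ^ α + (T / m) ^ β)) :
    ∃ R₁ R₂ : ℝ → ℝ, (R₁ =O[𝓝[>] 0] fun T : ℝ => (T / m) ^ α) ∧
      (R₂ =O[𝓝[>] 0] fun T : ℝ => (T / m) ^ β) ∧ ∀ T, E T = R₁ T + R₂ T := by
  have hsmall : ∀ᶠ T in 𝓝[>] (0 : ℝ), 0 < T / m ∧ T / m ≤ 1 := by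
    filter_upwards [Ioc_mem_nhdsGT hm] with T hT
    exact ⟨div_pos hT.1 hm, (div_le_one hm).mpr hT.2⟩
  have key {α β : ℝ} (hαβ : α ≤ β)
      (hE : ∀ᶠ T in 𝓝[>] (0 : ℝ), |E T| ≤ C * ((T / m) ^ α + (T / m) ^ β)) :
      E =O[𝓝[>] 0] fun T : ℝ => (T / m) ^ α := by
    refine IsBigO.of_bound (2 * C) ?_
    filter_upwards [hE, hsmall] with T h1 h2
    have h3 := Real.rpow_le_rpow_of_exponent_ge h2.1 h2.2 hαβ
    rw [Real.norm_eq_abs, Real.norm_of_nonneg (Real.rpow_nonneg h2.1.le _)]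
    nlinarith
  -- Near `0` the smaller exponent dominates, so the whole of `E` is charged to it and the other
  -- remainder is zero.
  rcases le_total α β with h | h
  · exact ⟨E, 0, key h hE, isBigO_zero _ _, fun T => by simp⟩
  · exact ⟨0, E, isBigO_zero _ _, key h (hE.mono fun T hT => by rwa [add_comm ((T / m) ^ β)]),
      fun T => by simp⟩

/-- Integrability and low temperature expansion of the Fermi-Dirac integral in terms of the
Fermi-Dirac functions, for every `D > 0`. -/
theorem fermiDiracIntegral_expansion {m : ℝ} (hm : 0 < m) {G : ℝ → ℝ}
    (hG : ContDiffOn ℝ 2 G (Set.Ici 0)) (hb : PolynomiallyBounded G) (B : ℝ) {γ : ℝ} (hγ : 0 < γ)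
    {D : ℝ} (hD : 0 < D) :
    (∀ T : ℝ, 0 < T → MeasureTheory.IntegrableOn
      (fermiDiracIntegrand D G m (chemicalPotential m B γ T) T) (Set.Ioi 0)) ∧
    ∃ R₁ R₂ : ℝ → ℝ,
      (R₁ =O[𝓝[>] 0] fun T : ℝ => (T / m) ^ (D / 2 + 1)) ∧
      (R₂ =O[𝓝[>] 0] fun T : ℝ => (T / m) ^ (D / 2 + 2 * γ)) ∧
      ∀ T : ℝ, 0 < T →
        fermiDiracIntegral D G m (chemicalPotential m B γ T) T =
          expansionCoeff D G m 0 * m ^ D * fermiJ (D / 2) 0 * (T / m) ^ (D / 2)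
          + expansionCoeff D G m 0 * m ^ D * B * (T / m) ^ (D / 2 + γ) * fermiJDeriv (D / 2)
          + expansionCoeff D G m 1 * m ^ D * fermiJ ((D + 1) / 2) 0 * (T / m) ^ ((D + 1) / 2)
          + R₁ T + R₂ T := by
  have hs : 0 < D / 2 := by positivity
  have hF := (contDiffOn_expansionFunction hG hm D).continuousOn
  obtain ⟨K, l, hK, hR⟩ := exists_abs_expansionFunction_sub_le hG hb hm D
  constructor
  · exact fun T hT => integrableOn_fermiDiracIntegrand hm hT
      (integral_fermiWeight_taylor hs hF hK hR (div_pos hT hm) _).1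
  obtain ⟨C, hC0, hC⟩ := integral_fermiWeight_expansion hs hF hK hR
  -- The error is defined as the exact difference, so the final identity holds for every `T > 0`
  -- although the bound holds only near `0`.
  set E : ℝ → ℝ := fun T => fermiDiracIntegral D G m (chemicalPotential m B γ T) T -
    (expansionCoeff D G m 0 * m ^ D * fermiJ (D / 2) 0 * (T / m) ^ (D / 2)
      + expansionCoeff D G m 0 * m ^ D * B * (T / m) ^ (D / 2 + γ) * fermiJDeriv (D / 2)
      + expansionCoeff D G m 1 * m ^ D * fermiJ ((D + 1) / 2) 0 * (T / m) ^ ((D + 1) / 2)) with hEdef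
  -- `γ > 0` makes `η = B t ^ γ` tend to `0`, as the expansion in `η` requires.
  have hη : ∀ᶠ T in 𝓝[>] (0 : ℝ), |B * (T / m) ^ γ| ≤ 1 := by
    have h : Tendsto (fun T : ℝ => |B * (T / m) ^ γ|) (𝓝 0) (𝓝 0) := by
      have hc : Continuous fun T : ℝ => |B * (T / m) ^ γ| :=
        (((continuous_id.div_const m).rpow_const fun _ => Or.inr hγ.le).const_mul B).abs
      simpa [Real.zero_rpow hγ.ne'] using hc.tendsto 0
    exact (h.mono_left nhdsWithin_le_nhds).eventually_le_const one_pos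
  have hE : ∀ᶠ T in 𝓝[>] (0 : ℝ),
      |E T| ≤ (m ^ D * C * (1 + B ^ 2)) * ((T / m) ^ (D / 2 + 1) + (T / m) ^ (D / 2 + 2 * γ)) := by
    filter_upwards [hη, Ioc_mem_nhdsGT hm] with T hT1 hT2
    have hT : 0 < T := hT2.1
    have ht : 0 < T / m := div_pos hT hm
    have h := hC (T / m) (B * (T / m) ^ γ) ht ((div_le_one hm).mpr hT2.2) hT1
    have hI := fermiDiracIntegral_eq hm hT D G (chemicalPotential m B γ T)
    rw [chemicalPotential_sub_div hm hT] at hI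
    set t := T / m
    have hpow : 0 < t ^ (D / 2) := Real.rpow_pos_of_pos ht _
    have e1 : t ^ (D / 2 + γ) = t ^ (D / 2) * t ^ γ := Real.rpow_add ht _ _
    have e2 : t ^ ((D + 1) / 2) = t ^ (D / 2) * √t := by
      rw [add_div, Real.rpow_add ht, Real.sqrt_eq_rpow]
    have e3 : t ^ (D / 2 + 1) = t ^ (D / 2) * t := by rw [Real.rpow_add ht, Real.rpow_one]
    have e4 : t ^ (D / 2 + 2 * γ) = t ^ (D / 2) * (t ^ γ) ^ 2 := by
      rw [Real.rpow_add ht, mul_comm 2 γ, Real.rpow_mul ht.le]; norm_cast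
    have e5 : (D + 1) / 2 = D / 2 + 1 / 2 := by ring
    rw [e3, e4]
    have hE' : E T = m ^ D * t ^ (D / 2) *
        ((∫ x in Set.Ioi (0 : ℝ), x ^ (D / 2 - 1) *
          (expansionFunction D G m √(t * x) * fermiWeight (B * t ^ γ) x)) -
        (expansionCoeff D G m 0 * (fermiJ (D / 2) 0 + B * t ^ γ * fermiJDeriv (D / 2)) +
          expansionCoeff D G m 1 * √t * fermiJ (D / 2 + 1 / 2) 0)) := by
      simp only [hEdef]
      rw [hI, e1, e2, e5]
      ring
    rw [hE', abs_mul, abs_of_pos (by positivity)]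
    calc _ ≤ m ^ D * t ^ (D / 2) * (C * (t + (B * t ^ γ) ^ 2)) := by gcongr
      _ = m ^ D * t ^ (D / 2) * C * (t + B ^ 2 * (t ^ γ) ^ 2) := by ring
      _ ≤ m ^ D * t ^ (D / 2) * C * ((1 + B ^ 2) * (t + (t ^ γ) ^ 2)) := by
          gcongr
          nlinarith [mul_nonneg (sq_nonneg B) ht.le, sq_nonneg (t ^ γ)]
      _ = _ := by ring
  obtain ⟨R₁, R₂, h1, h2, h3⟩ := exists_isBigO_add_of_abs_le hm (by positivity) hE
  refine ⟨R₁, R₂, h1, h2, fun T _ => ?_⟩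
  have := h3 T
  simp only [hEdef] at this
  linarith

end

/-! ### Closed forms of the coefficients -/

theorem mainTheorem4 (m : ℝ) (hm : 0 < m) (G : ℝ → ℝ)
    (hG : ContDiffOn ℝ 2 G (Set.Ici 0))
    (hGbound : ∀ j : ℕ, j ≤ 2 → PolynomiallyBounded (iteratedDerivWithin j G (Set.Ici 0)))
    (B γ : ℝ) (hγ : 0 < γ) :
    (∀ D : ℝ, 2 < D →
      (∀ T : ℝ, 0 < T → MeasureTheory.IntegrableOn
        (fermiDiracIntegrand D G m (chemicalPotential m B γ T) T) (Set.Ioi 0)) ∧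
      ∃ R₁ R₂ : ℝ → ℝ,
        (R₁ =O[𝓝[>] 0] fun T : ℝ => (T / m) ^ ((2 + D) / 2)) ∧
        (R₂ =O[𝓝[>] 0] fun T : ℝ => (T / m) ^ (D / 2 + 2 * γ)) ∧
        ∀ T : ℝ, 0 < T →
          fermiDiracIntegral D G m (chemicalPotential m B γ T) T =
            expansionCoeff D G m 0 * m ^ D * (1 - (2 : ℝ) ^ (-((D - 2) / 2))) *
                Real.Gamma (D / 2) * realZeta (D / 2) * (T / m) ^ (D / 2)
            + expansionCoeff D G m 0 * m ^ D * B * (T / m) ^ (D / 2 + γ) * ((D - 2) / 2) *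
                (if D = 4 then Real.log 2 else
                  (1 - (2 : ℝ) ^ (2 - D / 2)) * Real.Gamma ((D - 2) / 2) *
                    realZeta ((D - 2) / 2))
            + expansionCoeff D G m 1 * m ^ D * (1 - (2 : ℝ) ^ (-((D - 1) / 2))) *
                Real.Gamma ((D + 1) / 2) * realZeta ((D + 1) / 2) * (T / m) ^ ((D + 1) / 2)
            + R₁ T + R₂ T) ∧
    ((∀ T : ℝ, 0 < T → MeasureTheory.IntegrableOn
        (fermiDiracIntegrand 2 G m (chemicalPotential m B γ T) T) (Set.Ioi 0)) ∧
      ∃ R₁ R₂ : ℝ → ℝ,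
        (R₁ =O[𝓝[>] 0] fun T : ℝ => (T / m) ^ (1 + 2 * γ)) ∧
        (R₂ =O[𝓝[>] 0] fun T : ℝ => (T / m) ^ (2 : ℝ)) ∧
        ∀ T : ℝ, 0 < T →
          fermiDiracIntegral 2 G m (chemicalPotential m B γ T) T =
            expansionCoeff 2 G m 0 * m ^ 2 * Real.log 2 * (T / m)
            + 1 / 2 * expansionCoeff 2 G m 0 * m ^ 2 * B * (T / m) ^ (1 + γ)
            + expansionCoeff 2 G m 1 * m ^ 2 * (1 - (2 : ℝ) ^ (-(1 / 2) : ℝ)) *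
                (√Real.pi / 2) * realZeta (3 / 2) * (T / m) ^ (3 / 2 : ℝ)
            + R₁ T + R₂ T) := by
  have hb : PolynomiallyBounded G := by simpa using hGbound 0 (by norm_num)
  refine ⟨fun D hD => ?_, ?_⟩
  · obtain ⟨hint, R₁, R₂, h1, h2, h3⟩ :=
      fermiDiracIntegral_expansion hm hG hb B hγ (D := D) (by linarith)
    refine ⟨hint, R₁, R₂, ?_, h2, fun T hT => ?_⟩
    · rwa [show (2 + D) / 2 = D / 2 + 1 by ring]
    · have j1 := fermiJ_zero (s := D / 2) (by linarith) (by linarith)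
      have j2 := fermiJ_zero (s := (D + 1) / 2) (by linarith) (by linarith)
      -- `D = 4` is exactly the case `(D - 2) / 2 = 1`, where the zeta formula is not available.
      have j3 : fermiJ ((D - 2) / 2) 0 = if D = 4 then Real.log 2 else
          (1 - (2 : ℝ) ^ (2 - D / 2)) * Real.Gamma ((D - 2) / 2) * realZeta ((D - 2) / 2) := by
        split_ifs with h
        · rw [h, ← fermiJ_one_zero]; norm_num
        · rw [fermiJ_zero (by linarith) fun h' => h (by linarith),
            show 1 - (D - 2) / 2 = 2 - D / 2 by ring]
      have j4 := fermiJDeriv_eq (s := D / 2) (by linarith)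
      rw [show D / 2 - 1 = (D - 2) / 2 by ring, j3] at j4
      rw [show 1 - D / 2 = -((D - 2) / 2) by ring] at j1
      rw [show 1 - (D + 1) / 2 = -((D - 1) / 2) by ring] at j2
      rw [h3 T hT, j1, j2, j4]
      ring
  · obtain ⟨hint, R₁, R₂, h1, h2, h3⟩ :=
      fermiDiracIntegral_expansion hm hG hb B hγ (D := 2) (by norm_num)
    norm_num at h1 h2
    -- For `D = 2` the two remainders are listed in the opposite order.
    refine ⟨hint, R₂, R₁, h2, ?_, fun T hT => ?_⟩
    · simpa using h1
    · have j2 := fermiJ_zero (s := 3 / 2) (by norm_num) (by norm_num)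
      have hΓ : Real.Gamma (3 / 2) = √Real.pi / 2 := by
        rw [show (3 / 2 : ℝ) = 1 / 2 + 1 by norm_num, Real.Gamma_add_one (by norm_num),
          Real.Gamma_one_half_eq]
        ring
      rw [hΓ, show (1 - 3 / 2 : ℝ) = -(1 / 2) by norm_num] at j2
      rw [h3 T hT, show ((2 : ℝ) + 1) / 2 = 3 / 2 by norm_num, div_self two_ne_zero, j2,
        fermiJ_one_zero, fermiJDeriv_one, Real.rpow_one, Real.rpow_two]
      ring
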